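/- Consider $M\ge 1$ base stations (BSs) $i\in[M]$ and $K$ user equipments (UEs) $j\in[K]$. Each UE is associated with one BS; $\mathcal K_i$ is the set of UEs of BS $i$, and each BS $i$ serves one fixed selected UE $j(i)\in\mathcal K_i$. Let $\hbar_{j,i}=\sqrt{G^{\rm UE}_{j,i}G^{\rm BS}_{j,i}|h_{j,i}|^2d_{j,i}^{-\eta}}$ be the amplitude gain from BS $i$ to UE $j$, with antenna gains $G^{\rm UE}_{j,i},G^{\rm BS}_{j,i}>0$, distances $d_{j,i}>0$, path-loss exponent $\eta$, and fading coefficients $h_{j,i}$, where $h_{j(i),i}\neq 0$ for all $i$. Let $W>0$ be the bandwidth, $\sigma^2=N_0W$ with $N_0>0$ the noise power, $p_i^{\max}\ge 0$ the peak powers, and $\alpha_i,\lambda_i\ge 0$ the pricing factors. BS $i$ chooses $\mathbf p_i=(p_{j,i})_{j\in\mathcal K_i}$ in $$\mathcal P_i=\Big\{\mathbf p_i:\ p_{j,i}\ge 0,\ \sum_{j\in\mathcal K_i}p_{j,i}\le p_i^{\max},\ p_{j,i}=0 \text{ for } j\ne j(i)\Big\}$$ (so that only $p_{j(i),i}\in[0,p_i^{\max}]$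 is free) and maximizes the payoff $$\phi_i(\mathbf p_i,\mathbf p_{-i})=\alpha_i\sum_{j\in\mathcal K_i}W\log\left(1+\frac{\hbar_{j,i}^2\,p_{j,i}}{\sum_{\ell\ne i}\hbar_{j,\ell}^2\,p_{j(\ell),\ell}+\sigma^2}\right)-\lambda_i\sum_{j\in\mathcal K_i}p_{j,i}.$$ Let $\mathcal P=\prod_i\mathcal P_i$, and let $\mathbf F=(\mathbf F_i)_{i\in[M]}$ be the negative-gradient map: $\mathbf F_i(\mathbf p)\in\mathbb R^{\mathcal K_i}$ has the entry $-\partial\phi_i/\partial p_{j(i),i}$ at $j(i)$ and zeros elsewhere. Define $\mathbf Q\in\mathbb R^{M\times M}$ by $Q_{p,p}=\alpha_pW$ and, for $p\neq q$, $$Q_{p,q}=-\alpha_pW\left|\frac{\hbar_{j(p),q}}{\hbar_{j(q),q}}\right|^2\left(1+\frac{\sum_{i\in[M]}|\hbar_{j(q),i}|^2p_i^{\max}}{\sigma^2}\right).$$ If $\mathbf Q$ is a P-matrix (every principal minor is positive), then $\mathbf F$ is a uniformly P-function on $\mathcal P$, that is, there is a constant $C>0$ such that $$\max_{1\le i\le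 M}(\mathbf p_i-\mathbf p_i')^{\sf T}\big(\mathbf F_i(\mathbf p)-\mathbf F_i(\mathbf p')\big)\ \ge\ C\,\|\mathbf p-\mathbf p'\|_2^2\qquad\text{for all }\mathbf p,\mathbf p'\in\mathcal P,$$ and the game with action spaces $\mathcal P_i$ and payoffs $\phi_i$ has exactly one (pure-strategy) Nash equilibrium, i.e. exactly one $\mathbf p^\star\in\mathcal P$ with $\phi_i(\mathbf p_i^\star,\mathbf p_{-i}^\star)\ge\phi_i(\mathbf p_i,\mathbf p_{-i}^\star)$ for all $i$ and all $\mathbf p_i\in\mathcal P_i$. -/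

import Mathlib

/-- A real square matrix is a P-matrix if all of its principal minors are positive. -/
def IsPMatrix {n : Type*} [Fintype n] [DecidableEq n] (A : Matrix n n ℝ) : Prop :=
  ∀ s : Finset n, s.Nonempty →
    0 < (A.submatrix (Subtype.val : {x // x ∈ s} → n) (Subtype.val : {x // x ∈ s} → n)).det

/-- `F` is a uniformly P-function on the set `S` of block profiles `p = (p i)ᵢ`, where the block
`p i` is a real vector indexed by `J i`: for some `C > 0` and all `p, p' ∈ S`,
`max_i (p i - p' i)ᵀ (F p i - F p' i) ≥ C * ‖p - p'‖₂ ^ 2`. -/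
def IsUniformlyPFunctionOn {I : Type*} [Fintype I] [Nonempty I] {J : I → Type*}
    [∀ i, Fintype (J i)] (S : Set (∀ i, J i → ℝ)) (F : (∀ i, J i → ℝ) → ∀ i, J i → ℝ) : Prop :=
  ∃ C : ℝ, 0 < C ∧ ∀ p ∈ S, ∀ p' ∈ S,
    C * ∑ i, ∑ j, (p i j - p' i j) ^ 2 ≤
      Finset.univ.sup' Finset.univ_nonempty
        (fun i => ∑ j, (p i j - p' i j) * (F p i j - F p' i j))

/-- The data of the downlink power-allocation game with base stations (BSs) `Fin M` and user
equipments (UEs) `Fin K`, for one realization of the channel. -/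
structure PowerNetwork (M K : ℕ) where
  /-- the BS with which a UE is associated -/
  serving : Fin K → Fin M
  /-- the UE selected by each BS, among its own UEs -/
  sel : ∀ i : Fin M, {j : Fin K // serving j = i}
  /-- UE antenna gain between UE `j` and BS `i` -/
  GUE : Fin K → Fin M → ℝ
  /-- BS antenna gain between UE `j` and BS `i` -/
  GBS : Fin K → Fin M → ℝ
  /-- small-scale fading coefficient between UE `j` and BS `i` -/
  h : Fin K → Fin M → ℝ
  /-- distance between UE `j` and BS `i` -/
  d : Fin K → Fin M → ℝ
  /-- path-loss exponent -/
  η : ℝ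
  /-- bandwidth -/
  W : ℝ
  /-- noise power spectral density -/
  N₀ : ℝ
  /-- peak transmit powers -/
  pmax : Fin M → ℝ
  /-- pricing factors of the throughput -/
  α : Fin M → ℝ
  /-- pricing factors of the power consumption -/
  lam : Fin M → ℝ
  GUE_pos : ∀ j i, 0 < GUE j i
  GBS_pos : ∀ j i, 0 < GBS j i
  h_sel_ne_zero : ∀ i, h (sel i).1 i ≠ 0
  d_pos : ∀ j i, 0 < d j i
  W_pos : 0 < W
  N₀_pos : 0 < N₀
  pmax_nonneg : ∀ i, 0 ≤ pmax i
  α_nonneg : ∀ i, 0 ≤ α i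
  lam_nonneg : ∀ i, 0 ≤ lam i

namespace PowerNetwork

variable {M K : ℕ} (N : PowerNetwork M K)

/-- The UEs associated with BS `i`. -/
abbrev UEs (i : Fin M) : Type := {j : Fin K // N.serving j = i}

/-- Power allocation profiles: `p i j` is the power of BS `i` towards its UE `j`. -/
abbrev Profile : Type := ∀ i : Fin M, N.UEs i → ℝ

/-- The amplitude gain `ℏ_{j,i}` of the link from BS `i` to UE `j`. -/
noncomputable def hbar (j : Fin K) (i : Fin M) : ℝ :=
  Real.sqrt (N.GUE j i * N.GBS j i * |N.h j i| ^ 2 * N.d j i ^ (-N.η))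

/-- The total noise power `σ²`. -/
noncomputable def noise : ℝ := N.N₀ * N.W

/-- The equivalent channel gain of UE `j` of BS `i`: the other BSs interfere with the powers they
allocate to their selected UEs. -/
noncomputable def gain (p : N.Profile) (i : Fin M) (j : N.UEs i) : ℝ :=
  N.GUE j i * N.GBS j i * |N.h j i| ^ 2 * N.d j i ^ (-N.η) /
    (∑ l ∈ Finset.univ.erase i,
        p l (N.sel l) * (N.GUE j l * N.GBS j l * |N.h j l| ^ 2 * N.d j l ^ (-N.η)) + N.noise)

/-- The signal-to-interference-plus-noise ratio at UE `j` of BS `i`. -/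
noncomputable def SINR (p : N.Profile) (i : Fin M) (j : N.UEs i) : ℝ :=
  N.gain p i j * p i j

/-- The payoff of BS `i`. -/
noncomputable def payoff (i : Fin M) (p : N.Profile) : ℝ :=
  N.α i * ∑ j : N.UEs i, N.W * Real.log (1 + N.SINR p i j) - N.lam i * ∑ j : N.UEs i, p i j

/-- The action space of BS `i`: nonnegative powers of total at most `pmax i`, where only the
selected UE is served. -/
def actions (i : Fin M) : Set (N.UEs i → ℝ) :=
  {x | (∀ j, 0 ≤ x j) ∧ ∑ j, x j ≤ N.pmax i ∧ ∀ j, j ≠ N.sel i → x j = 0}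

/-- The product of the action spaces. -/
def profiles : Set N.Profile := {p | ∀ i, p i ∈ N.actions i}

/-- Pure-strategy Nash equilibria of the power-allocation game. -/
def IsNash (p : N.Profile) : Prop :=
  p ∈ N.profiles ∧
    ∀ i, ∀ x ∈ N.actions i, N.payoff i (Function.update p i x) ≤ N.payoff i p

/-- The negative-gradient map: the only nonzero entry of the block `F p i` is the negative of the
derivative of the payoff of BS `i` in its power towards its selected UE. -/
noncomputable def F (p : N.Profile) : N.Profile := fun i j =>
  if j = N.sel i then
    -deriv (fun t => N.payoff i (Function.update p i (Function.update (p i) (N.sel i) t)))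
      (p i (N.sel i))
  else 0

theorem noise_pos : 0 < N.noise := mul_pos N.N₀_pos N.W_pos

theorem gain_nonneg {p : N.Profile} (hp : p ∈ N.profiles) (i : Fin M) (j : N.UEs i) :
    0 ≤ N.gain p i j := by
  have hb : ∀ l, 0 ≤ N.GUE j l * N.GBS j l * |N.h j l| ^ 2 * N.d j l ^ (-N.η) := fun l =>
    mul_nonneg (mul_nonneg (mul_nonneg (N.GUE_pos _ _).le (N.GBS_pos _ _).le) (sq_nonneg _))
      (Real.rpow_nonneg (N.d_pos _ _).le _)
  exact div_nonneg (hb i) (add_nonneg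
    (Finset.sum_nonneg fun l _ => mul_nonneg ((hp l).1 _) (hb l)) N.noise_pos.le)

theorem gain_update (p : N.Profile) (i : Fin M) (x : N.UEs i → ℝ) (j : N.UEs i) :
    N.gain (Function.update p i x) i j = N.gain p i j := by
  unfold gain
  congr 2
  refine Finset.sum_congr rfl fun l hl => ?_
  rw [Function.update_of_ne (Finset.ne_of_mem_erase hl)]

/-- On the action spaces, the derivative in the definition of `F` exists, and has the expected
value. -/
theorem hasDerivAt_payoff {p : N.Profile} (hp : p ∈ N.profiles) (i : Fin M) :
    HasDerivAt
      (fun t => N.payoff i (Function.update p i (Function.update (p i) (N.sel i) t)))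
      (N.α i * N.gain p i (N.sel i) * N.W / (1 + N.gain p i (N.sel i) * p i (N.sel i)) - N.lam i)
      (p i (N.sel i)) := by
  have hg := N.gain_nonneg hp i (N.sel i)
  have h1 : 1 + N.gain p i (N.sel i) * p i (N.sel i) ≠ 0 :=
    (add_pos_of_pos_of_nonneg one_pos (mul_nonneg hg ((hp i).1 _))).ne'
  have hf : (fun t => N.payoff i (Function.update p i (Function.update (p i) (N.sel i) t))) =
      fun t => N.α i * (N.W * Real.log (1 + N.gain p i (N.sel i) * t)) - N.lam i * t := by
    funext t
    have hz : ∀ j, j ≠ N.sel i → p i j = 0 := (hp i).2.2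
    unfold payoff
    rw [Finset.sum_eq_single (N.sel i), Finset.sum_eq_single (N.sel i)]
    · simp [SINR, gain_update]
    · intro j _ hj
      simp [hj, hz j hj]
    · simp
    · intro j _ hj
      simp [SINR, hj, hz j hj]
    · simp
  rw [hf]
  have hlin : HasDerivAt (fun t => 1 + N.gain p i (N.sel i) * t) (N.gain p i (N.sel i))
      (p i (N.sel i)) := by
    simpa using ((hasDerivAt_id (p i (N.sel i))).const_mul (N.gain p i (N.sel i))).const_add 1
  have := (((hlin.log h1).const_mul N.W).const_mul (N.α i)).sub
    ((hasDerivAt_id (p i (N.sel i))).const_mul (N.lam i))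
  refine this.congr_deriv ?_
  ring

/-- The matrix `Q`. -/
noncomputable def Q : Matrix (Fin M) (Fin M) ℝ := Matrix.of fun p q =>
  if p = q then N.α p * N.W
  else
    -(N.α p * N.W) * |N.hbar (N.sel p) q / N.hbar (N.sel q) q| ^ 2 *
      (1 + (∑ i, |N.hbar (N.sel q) i| ^ 2 * N.pmax i) / N.noise)

end PowerNetwork

/-!
On the action spaces, the block of `F` at base station `i` depends on the powers only through the
total power `T i` received at its selected user:
`F i = lam i - α i * W * c i i / T i` with `T i = σ² + ∑ l, c i l * p l`, where `c i l` is the squared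
amplitude gain from base station `l` to the selected user of `i`. So its increment is
`α i * W * c i i / (T i * T' i) * ∑ l, c i l * (p l - p' l)`: row `i` of the nonnegative matrix `c`
applied to the increment of the powers, up to a positive factor that is bounded below.

A P-matrix with nonpositive off-diagonal entries maps some positive vector to a positive vector
(`Matrix.exists_pos_mulVec_pos_of_minors_pos`). Applied to `Q`, this says that `c` is diagonally
dominant with positive column weights `v` (`PowerNetwork.exists_crossGain_dominant`). Two things
follow.

* At an index that maximizes `|p i - p' i| / v i`, the diagonal term of row `i` outweighs the others
  (`exists_coercive_of_dominant`), which gives the uniform P-property. Since Nash equilibria satisfy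
  the first-order conditions (`PowerNetwork.IsNash.variational`), there is at most one.
* The water-filling best response contracts the supremum norm weighted by `v`
  (`exists_fixedPoint_of_dominant`), so the Banach fixed point theorem provides a fixed point. It is
  an equilibrium because the payoffs are concave in the own power
  (`PowerNetwork.isNash_of_bestResponse_eq`).
-/

/-! ### P-matrices with nonpositive off-diagonal entries -/

/-- One step of Gaussian elimination: the determinant through the Schur complement of the upper left
entry. -/
theorem Matrix.det_eq_mul_det_schur {n : ℕ} (A : Matrix (Fin (n + 1)) (Fin (n + 1)) ℝ)
    (h : A 0 0 ≠ 0) :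
    A.det = A 0 0 *
      (Matrix.of fun i j : Fin n => A i.succ j.succ - A i.succ 0 * A 0 j.succ / A 0 0).det := by
  let B : Matrix (Fin (n + 1)) (Fin (n + 1)) ℝ := Matrix.of fun i j =>
    Fin.cases (A 0 j) (fun i' => A i'.succ j - A i'.succ 0 / A 0 0 * A 0 j) i
  have hAB : A.det = B.det := by
    refine Matrix.det_eq_of_forall_row_eq_smul_add_const
      (Fin.cases 0 fun i => A i.succ 0 / A 0 0) 0 rfl fun i j => ?_
    cases i using Fin.cases <;> simp [B]
  rw [hAB, Matrix.det_succ_column_zero, Finset.sum_eq_single 0]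
  · have hS : B.submatrix (Fin.succAbove 0) Fin.succ =
        Matrix.of fun i j : Fin n => A i.succ j.succ - A i.succ 0 * A 0 j.succ / A 0 0 := by
      ext i j
      simp [B]
      ring
    rw [hS]
    simp [B]
  · intro i _ hi
    obtain ⟨k, rfl⟩ := Fin.exists_succ_eq.2 hi
    simp [B, h]
  · simp

/-- A P-matrix with nonpositive off-diagonal entries is semipositive. The Schur complement of the
upper left entry is again such a matrix, and a positive vector for it extends to one for `A`. The
minors are indexed by injections `Fin m → Fin n`, which makes the induction free of reindexing. -/
theorem Matrix.exists_pos_mulVec_pos_of_minors_pos {n : ℕ} (A : Matrix (Fin n) (Fin n) ℝ)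
    (hZ : ∀ i j, i ≠ j → A i j ≤ 0)
    (hP : ∀ (m : ℕ) (f : Fin m → Fin n), Function.Injective f → 0 < (A.submatrix f f).det) :
    ∃ v : Fin n → ℝ, (∀ i, 0 < v i) ∧ ∀ i, 0 < (A.mulVec v) i := by
  induction n with
  | zero => exact ⟨0, fun i => i.elim0, fun i => i.elim0⟩
  | succ n ih =>
    have ha : 0 < A 0 0 := by
      have := hP 1 (fun _ => 0) (Function.injective_of_subsingleton _)
      simpa using this
    have hr : ∀ j : Fin n, A 0 j.succ ≤ 0 := fun j => hZ _ _ (Fin.succ_ne_zero j).symm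
    have hc : ∀ j : Fin n, A j.succ 0 ≤ 0 := fun j => hZ _ _ (Fin.succ_ne_zero j)
    obtain ⟨v, hv, hSv⟩ := ih
      (Matrix.of fun i j : Fin n => A i.succ j.succ - A i.succ 0 * A 0 j.succ / A 0 0)
      (fun i j hij => by
        have h1 := hZ i.succ j.succ (by simpa using hij)
        have h2 := div_nonneg (mul_nonneg_of_nonpos_of_nonpos (hc i) (hr j)) ha.le
        simp only [Matrix.of_apply]
        linarith)
      (fun m f hf => by
        have hg : Function.Injective (Fin.cons 0 (Fin.succ ∘ f) : Fin (m + 1) → Fin (n + 1)) :=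
          Fin.cons_injective_iff.2
            ⟨by simp [Fin.succ_ne_zero], (Fin.succ_injective n).comp hf⟩
        have hdet := hP (m + 1) _ hg
        rw [Matrix.det_eq_mul_det_schur _ (by simpa using ha.ne')] at hdet
        exact pos_of_mul_pos_right hdet (by simpa using ha.le))
    -- The perturbation of `v 0` must keep the other coordinates of `A v` positive.
    obtain ⟨ε, hε, hεv⟩ : ∃ ε : ℝ, 0 < ε ∧ ∀ i : Fin n, 0 < ((Matrix.of fun i j : Fin n =>
        A i.succ j.succ - A i.succ 0 * A 0 j.succ / A 0 0).mulVec v) i + A i.succ 0 * ε := by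
      have hev : ∀ᶠ ε : ℝ in nhdsWithin 0 (Set.Ioi 0), ∀ i : Fin n, 0 < ((Matrix.of
          fun i j : Fin n => A i.succ j.succ - A i.succ 0 * A 0 j.succ / A 0 0).mulVec v) i +
            A i.succ 0 * ε := by
        refine Filter.eventually_all.2 fun i => nhdsWithin_le_nhds ?_
        refine ContinuousAt.eventually_lt continuousAt_const (by fun_prop) ?_
        simpa using hSv i
      obtain ⟨ε, h1, h2⟩ := (hev.and self_mem_nhdsWithin).exists
      exact ⟨ε, h2, h1⟩
    have hs : 0 ≤ -(∑ j, A 0 j.succ * v j) / A 0 0 :=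
      div_nonneg (neg_nonneg.2 (Finset.sum_nonpos fun j _ =>
        mul_nonpos_of_nonpos_of_nonneg (hr j) (hv j).le)) ha.le
    refine ⟨Fin.cons (-(∑ j, A 0 j.succ * v j) / A 0 0 + ε) v, ?_, ?_⟩
    · intro i
      cases i using Fin.cases with
      | zero => simpa using add_pos_of_nonneg_of_pos hs hε
      | succ i => simpa using hv i
    · intro i
      cases i using Fin.cases with
      | zero =>
        have : (A.mulVec (Fin.cons (-(∑ j, A 0 j.succ * v j) / A 0 0 + ε) v)) 0 = A 0 0 * ε := by
          simp only [Matrix.mulVec, dotProduct, Fin.sum_univ_succ, Fin.cons_zero, Fin.cons_succ]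
          field_simp
          ring
        rw [this]
        positivity
      | succ i =>
        convert hεv i using 1
        simp only [Matrix.mulVec, dotProduct, Fin.sum_univ_succ, Fin.cons_zero, Fin.cons_succ,
          Matrix.of_apply, sub_mul, Finset.sum_sub_distrib]
        have : ∑ j, A i.succ 0 * A 0 j.succ / A 0 0 * v j =
            A i.succ 0 * (∑ j, A 0 j.succ * v j) / A 0 0 := by
          rw [Finset.mul_sum, Finset.sum_div]
          exact Finset.sum_congr rfl fun j _ => by ring
        rw [this]
        ring

theorem IsPMatrix.det_submatrix_pos {n : ℕ} {A : Matrix (Fin n) (Fin n) ℝ} (hA : IsPMatrix A)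
    {m : ℕ} {f : Fin m → Fin n} (hf : Function.Injective f) : 0 < (A.submatrix f f).det := by
  rcases Nat.eq_zero_or_pos m with rfl | hm
  · simp
  · let e : Fin m ≃ {x // x ∈ Finset.univ.image f} :=
      Equiv.ofBijective (fun k => ⟨f k, by simp⟩)
        ⟨fun a b h => hf (congrArg Subtype.val h), fun ⟨x, hx⟩ => by
          obtain ⟨k, -, rfl⟩ := Finset.mem_image.1 hx
          exact ⟨k, rfl⟩⟩
    have := hA (Finset.univ.image f) ⟨f ⟨0, hm⟩, by simp⟩
    rwa [← Matrix.det_submatrix_equiv_self e] at this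

/-! ### Diagonally dominant matrices -/

/-- For a nonnegative matrix `c` that is diagonally dominant with column weights `v`, the map
`δ ↦ c δ` is a uniformly P-function: an index that maximizes `|δ i| / v i` is a witness. -/
theorem exists_coercive_of_dominant {M : ℕ} [NeZero M] {c : Fin M → Fin M → ℝ}
    (hc : ∀ i l, 0 ≤ c i l) {v : Fin M → ℝ} (hv : ∀ i, 0 < v i)
    (hd : ∀ i, ∑ l ∈ Finset.univ.erase i, c i l * v l < c i i * v i) :
    ∃ κ : ℝ, 0 < κ ∧ ∀ δ : Fin M → ℝ, ∃ i, κ * ∑ l, δ l ^ 2 ≤ δ i * ∑ l, c i l * δ l := by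
  have hV : 0 < ∑ l, v l ^ 2 :=
    Finset.sum_pos (fun l _ => pow_pos (hv l) 2) Finset.univ_nonempty
  let r : Fin M → ℝ := fun i => v i * (c i i * v i - ∑ l ∈ Finset.univ.erase i, c i l * v l)
  have hr : ∀ i, 0 < r i := fun i => mul_pos (hv i) (sub_pos.2 (hd i))
  obtain ⟨i₀, -, hi₀⟩ := Finset.exists_min_image Finset.univ r Finset.univ_nonempty
  refine ⟨r i₀ / ∑ l, v l ^ 2, div_pos (hr i₀) hV, fun δ => ?_⟩
  obtain ⟨i, -, hi⟩ :=
    Finset.exists_max_image Finset.univ (fun i => |δ i| / v i) Finset.univ_nonempty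
  refine ⟨i, ?_⟩
  set m := |δ i| / v i with hm
  have hm0 : 0 ≤ m := div_nonneg (abs_nonneg _) (hv i).le
  have hδ : ∀ l, |δ l| ≤ m * v l := fun l => (div_le_iff₀ (hv l)).1 (hi l (Finset.mem_univ l))
  have hδi : |δ i| = m * v i := by rw [hm]; field_simp [(hv i).ne']
  have h1 : ∑ l, δ l ^ 2 ≤ m ^ 2 * ∑ l, v l ^ 2 := by
    rw [Finset.mul_sum]
    refine Finset.sum_le_sum fun l _ => ?_
    rw [← sq_abs, ← mul_pow]
    exact pow_le_pow_left₀ (abs_nonneg _) (hδ l) 2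
  have h2 : r i₀ / (∑ l, v l ^ 2) * ∑ l, δ l ^ 2 ≤ m ^ 2 * r i := by
    calc r i₀ / (∑ l, v l ^ 2) * ∑ l, δ l ^ 2
        ≤ r i₀ / (∑ l, v l ^ 2) * (m ^ 2 * ∑ l, v l ^ 2) :=
          mul_le_mul_of_nonneg_left h1 (div_pos (hr i₀) hV).le
      _ = m ^ 2 * r i₀ := by field_simp
      _ ≤ m ^ 2 * r i := mul_le_mul_of_nonneg_left (hi₀ i (Finset.mem_univ i)) (sq_nonneg m)
  refine h2.trans ?_
  rw [← Finset.add_sum_erase _ _ (Finset.mem_univ i), mul_add]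
  have h3 : δ i * (c i i * δ i) = c i i * (m * v i) ^ 2 := by
    rw [← hδi, sq_abs]
    ring
  have h4 : -(m * v i * (m * ∑ l ∈ Finset.univ.erase i, c i l * v l)) ≤
      δ i * ∑ l ∈ Finset.univ.erase i, c i l * δ l := by
    refine neg_le_of_abs_le ?_
    rw [abs_mul, hδi]
    refine mul_le_mul_of_nonneg_left ?_ (mul_nonneg hm0 (hv i).le)
    refine (Finset.abs_sum_le_sum_abs _ _).trans ?_
    rw [Finset.mul_sum]
    refine Finset.sum_le_sum fun l _ => ?_
    rw [abs_mul, abs_of_nonneg (hc i l)]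
    calc c i l * |δ l| ≤ c i l * (m * v l) := mul_le_mul_of_nonneg_left (hδ l) (hc i l)
      _ = m * (c i l * v l) := by ring
  rw [h3]
  simp only [r]
  linarith

/-- A map whose increments are bounded by the Jacobi iteration matrix of a diagonally dominant matrix
contracts a weighted supremum norm, and so has a fixed point. -/
theorem exists_fixedPoint_of_dominant {M : ℕ} [NeZero M] {c : Fin M → Fin M → ℝ}
    (hc : ∀ i l, 0 ≤ c i l) (hc' : ∀ i, 0 < c i i) {v : Fin M → ℝ} (hv : ∀ i, 0 < v i)
    (hd : ∀ i, ∑ l ∈ Finset.univ.erase i, c i l * v l < c i i * v i)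
    {B : (Fin M → ℝ) → Fin M → ℝ}
    (hB : ∀ x y i, |B x i - B y i| ≤ (∑ l ∈ Finset.univ.erase i, c i l * |x l - y l|) / c i i) :
    ∃ x, B x = x := by
  let ρ : Fin M → ℝ := fun i => (∑ l ∈ Finset.univ.erase i, c i l * v l) / (c i i * v i)
  have hρ0 : ∀ i, 0 ≤ ρ i := fun i =>
    div_nonneg (Finset.sum_nonneg fun l _ => mul_nonneg (hc i l) (hv l).le)
      (mul_pos (hc' i) (hv i)).le
  have hρ1 : ∀ i, ρ i < 1 := fun i => (div_lt_one (mul_pos (hc' i) (hv i))).2 (hd i)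
  obtain ⟨i₀, -, hi₀⟩ := Finset.exists_max_image Finset.univ ρ Finset.univ_nonempty
  -- In the coordinates `x l / v l` the map `B` contracts the supremum norm.
  let T : (Fin M → ℝ) → Fin M → ℝ := fun z i => B (fun l => v l * z l) i / v i
  have hT : ContractingWith ⟨ρ i₀, hρ0 i₀⟩ T := by
    refine ⟨by exact_mod_cast hρ1 i₀, LipschitzWith.of_dist_le_mul fun z w => ?_⟩
    refine (dist_pi_le_iff (mul_nonneg (hρ0 i₀) dist_nonneg)).2 fun i => ?_
    change dist (T z i) (T w i) ≤ ρ i₀ * dist z w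
    rw [Real.dist_eq]
    simp only [T]
    rw [← sub_div, abs_div, abs_of_pos (hv i)]
    calc |B (fun l => v l * z l) i - B (fun l => v l * w l) i| / v i
        ≤ ((∑ l ∈ Finset.univ.erase i, c i l * |v l * z l - v l * w l|) / c i i) / v i := by
          have := hv i
          gcongr
          exact hB _ _ i
      _ ≤ ((∑ l ∈ Finset.univ.erase i, c i l * (v l * dist z w)) / c i i) / v i := by
          have h1 := hv i
          have h2 := hc' i
          gcongr with l _
          · exact hc i l
          · rw [← mul_sub, abs_mul, abs_of_pos (hv l)]
            exact mul_le_mul_of_nonneg_left (dist_le_pi_dist z w l) (hv l).le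
      _ = ρ i * dist z w := by
          simp only [ρ, ← mul_assoc, ← Finset.sum_mul]
          rw [div_div]
          ring
      _ ≤ ρ i₀ * dist z w :=
          mul_le_mul_of_nonneg_right (hi₀ i (Finset.mem_univ i)) dist_nonneg
  have hfix := hT.fixedPoint_isFixedPt
  refine ⟨fun l => v l * hT.fixedPoint T l, funext fun i => ?_⟩
  have := congrFun hfix i
  simp only [T] at this
  rw [div_eq_iff (hv i).ne'] at this
  rw [this, mul_comm]

namespace PowerNetwork

variable {M K : ℕ} (N : PowerNetwork M K)

/-! ### Gains and received power -/

/-- The squared amplitude gain of the link from BS `l` to the selected UE of BS `i`. -/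
noncomputable def crossGain (i l : Fin M) : ℝ :=
  N.GUE (N.sel i) l * N.GBS (N.sel i) l * |N.h (N.sel i) l| ^ 2 * N.d (N.sel i) l ^ (-N.η)

/-- The total power received at the selected UE of BS `i`: noise, interference and signal, when
BS `l` sends with power `x l`. -/
noncomputable def received (x : Fin M → ℝ) (i : Fin M) : ℝ :=
  N.noise + ∑ l, N.crossGain i l * x l

theorem crossGain_nonneg (i l : Fin M) : 0 ≤ N.crossGain i l :=
  mul_nonneg (mul_nonneg (mul_nonneg (N.GUE_pos _ _).le (N.GBS_pos _ _).le) (sq_nonneg _))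
    (Real.rpow_nonneg (N.d_pos _ _).le _)

theorem crossGain_self_pos (i : Fin M) : 0 < N.crossGain i i :=
  mul_pos (mul_pos (mul_pos (N.GUE_pos _ _) (N.GBS_pos _ _))
    (pow_pos (abs_pos.2 (N.h_sel_ne_zero i)) 2)) (Real.rpow_pos_of_pos (N.d_pos _ _) _)

theorem abs_hbar_sel_sq (i l : Fin M) : |N.hbar (N.sel i) l| ^ 2 = N.crossGain i l := by
  rw [sq_abs, hbar, ← crossGain, Real.sq_sqrt (N.crossGain_nonneg i l)]

theorem received_pos {x : Fin M → ℝ} (hx : ∀ l, 0 ≤ x l) (i : Fin M) : 0 < N.received x i :=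
  add_pos_of_pos_of_nonneg N.noise_pos
    (Finset.sum_nonneg fun l _ => mul_nonneg (N.crossGain_nonneg i l) (hx l))

theorem received_mono {x y : Fin M → ℝ} (h : ∀ l, x l ≤ y l) (i : Fin M) :
    N.received x i ≤ N.received y i :=
  add_le_add_right (Finset.sum_le_sum fun l _ =>
    mul_le_mul_of_nonneg_left (h l) (N.crossGain_nonneg i l)) _

theorem received_eq (x : Fin M → ℝ) (i : Fin M) :
    N.received x i = N.crossGain i i * x i +
      (∑ l ∈ Finset.univ.erase i, N.crossGain i l * x l + N.noise) := by
  rw [received, ← Finset.add_sum_erase _ _ (Finset.mem_univ i)]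
  ring

theorem gain_sel (p : N.Profile) (i : Fin M) :
    N.gain p i (N.sel i) = N.crossGain i i /
      (∑ l ∈ Finset.univ.erase i, N.crossGain i l * p l (N.sel l) + N.noise) := by
  simp only [gain, crossGain]
  congr 2
  exact Finset.sum_congr rfl fun l _ => mul_comm _ _

theorem interference_pos {x : Fin M → ℝ} (hx : ∀ l, 0 ≤ x l) (i : Fin M) :
    0 < ∑ l ∈ Finset.univ.erase i, N.crossGain i l * x l + N.noise :=
  add_pos_of_nonneg_of_pos
    (Finset.sum_nonneg fun l _ => mul_nonneg (N.crossGain_nonneg i l) (hx l)) N.noise_pos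

/-- The marginal rate, in which the interference at the selected UE enters only through the total
received power. -/
theorem gain_div_one_add {p : N.Profile} (hp : p ∈ N.profiles) (i : Fin M) :
    N.gain p i (N.sel i) / (1 + N.gain p i (N.sel i) * p i (N.sel i)) =
      N.crossGain i i / N.received (fun l => p l (N.sel l)) i := by
  have hD := N.interference_pos (x := fun l => p l (N.sel l)) (fun l => (hp l).1 _) i
  have hT := N.received_pos (x := fun l => p l (N.sel l)) (fun l => (hp l).1 _) i
  rw [received_eq] at hT
  rw [gain_sel, received_eq]
  have h1 : 1 + N.crossGain i i /
      (∑ l ∈ Finset.univ.erase i, N.crossGain i l * p l (N.sel l) + N.noise) * p i (N.sel i) =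
      (N.crossGain i i * p i (N.sel i) +
        (∑ l ∈ Finset.univ.erase i, N.crossGain i l * p l (N.sel l) + N.noise)) /
      (∑ l ∈ Finset.univ.erase i, N.crossGain i l * p l (N.sel l) + N.noise) := by
    field_simp
    ring
  rw [h1, div_div_div_cancel_right₀ hD.ne']

theorem F_sel {p : N.Profile} (hp : p ∈ N.profiles) (i : Fin M) :
    N.F p i (N.sel i) = N.lam i -
      N.α i * N.W * (N.crossGain i i / N.received (fun l => p l (N.sel l)) i) := by
  rw [F, if_pos rfl, (N.hasDerivAt_payoff hp i).deriv, ← N.gain_div_one_add hp]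
  ring

/-! ### Equilibria and first-order conditions -/

theorem sum_eq_sel {i : Fin M} {f : N.UEs i → ℝ} (h : ∀ j, j ≠ N.sel i → f j = 0) :
    ∑ j, f j = f (N.sel i) :=
  Finset.sum_eq_single _ (fun j _ hj => h j hj) (by simp)

theorem le_pmax {i : Fin M} {x : N.UEs i → ℝ} (hx : x ∈ N.actions i) : x (N.sel i) ≤ N.pmax i :=
  N.sum_eq_sel hx.2.2 ▸ hx.2.1

theorem single_mem_actions {i : Fin M} {t : ℝ} (h0 : 0 ≤ t) (h1 : t ≤ N.pmax i) :
    Pi.single (N.sel i) t ∈ N.actions i := by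
  refine ⟨fun j => ?_, by simpa using h1, fun j hj => by simp [hj]⟩
  by_cases hj : j = N.sel i
  · subst hj; simpa using h0
  · simp [hj]

theorem eq_single_of_mem_actions {i : Fin M} {x : N.UEs i → ℝ} (hx : x ∈ N.actions i) :
    x = Pi.single (N.sel i) (x (N.sel i)) := by
  funext j
  by_cases hj : j = N.sel i
  · subst hj; simp
  · simp [hj, hx.2.2 j hj]

theorem payoff_update (p : N.Profile) {i : Fin M} {x : N.UEs i → ℝ} (hx : x ∈ N.actions i) :
    N.payoff i (Function.update p i x) =
      N.α i * (N.W * Real.log (1 + N.gain p i (N.sel i) * x (N.sel i))) -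
        N.lam i * x (N.sel i) := by
  unfold payoff
  rw [N.sum_eq_sel, N.sum_eq_sel]
  · simp [SINR, gain_update]
  · intro j hj
    simp [hx.2.2 j hj]
  · intro j hj
    simp [SINR, hx.2.2 j hj]

/-- The payoff is concave in the own power, so that the first-order condition is sufficient: the
inequality `log u ≤ u - 1` bounds the payoff by its tangent. -/
theorem isNash_of_variational {p : N.Profile} (hp : p ∈ N.profiles)
    (h : ∀ i, ∀ t, 0 ≤ t → t ≤ N.pmax i → 0 ≤ (t - p i (N.sel i)) * N.F p i (N.sel i)) :
    N.IsNash p := by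
  refine ⟨hp, fun i x hx => ?_⟩
  have hself := N.payoff_update p (hp i)
  rw [Function.update_eq_self] at hself
  rw [hself, N.payoff_update p hx]
  have hvi := h i _ (hx.1 (N.sel i)) (N.le_pmax hx)
  rw [N.F_sel hp, ← N.gain_div_one_add hp] at hvi
  set g := N.gain p i (N.sel i)
  have hg : 0 ≤ g := N.gain_nonneg hp i _
  set t := x (N.sel i)
  set s := p i (N.sel i)
  have hu : 0 < 1 + g * t := add_pos_of_pos_of_nonneg one_pos (mul_nonneg hg (hx.1 _))
  have hw : 0 < 1 + g * s := add_pos_of_pos_of_nonneg one_pos (mul_nonneg hg ((hp i).1 _))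
  have hlog : Real.log (1 + g * t) - Real.log (1 + g * s) ≤ (t - s) * (g / (1 + g * s)) := by
    rw [← Real.log_div hu.ne' hw.ne']
    refine (Real.log_le_sub_one_of_pos (div_pos hu hw)).trans_eq ?_
    field_simp
    ring
  have := mul_le_mul_of_nonneg_left hlog (mul_nonneg (N.α_nonneg i) N.W_pos.le)
  linarith

theorem IsNash.variational {N : PowerNetwork M K} {p : N.Profile} (h : N.IsNash p) (i : Fin M)
    {t : ℝ} (h0 : 0 ≤ t) (h1 : t ≤ N.pmax i) :
    0 ≤ (t - p i (N.sel i)) * N.F p i (N.sel i) := by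
  have hp := h.1
  have hder := N.hasDerivAt_payoff hp i
  set f : ℝ → ℝ :=
    fun t => N.payoff i (Function.update p i (Function.update (p i) (N.sel i) t)) with hf
  have hF : N.F p i (N.sel i) = -deriv f (p i (N.sel i)) := by rw [F, if_pos rfl]
  have hmax : IsMaxOn f (Set.Icc 0 (N.pmax i)) (p i (N.sel i)) := by
    intro s hs
    have hupd : Function.update (p i) (N.sel i) s = Pi.single (N.sel i) s := by
      conv_lhs => rw [N.eq_single_of_mem_actions (hp i)]
      simp [Pi.single]
    have := h.2 i _ (N.single_mem_actions hs.1 hs.2)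
    simpa [hf, hupd] using this
  have hs : p i (N.sel i) ∈ Set.Icc 0 (N.pmax i) := ⟨(hp i).1 _, N.le_pmax (hp i)⟩
  have hcone : t - p i (N.sel i) ∈
      posTangentConeAt (Set.Icc 0 (N.pmax i)) (p i (N.sel i)) :=
    sub_mem_posTangentConeAt_of_segment_subset
      ((convex_Icc _ _).segment_subset hs ⟨h0, h1⟩)
  have := hmax.localize.hasFDerivWithinAt_nonpos
    hder.differentiableAt.hasDerivAt.hasFDerivAt.hasFDerivWithinAt hcone
  rw [hF]
  simp at this
  linarith

/-! ### Diagonal dominance and the uniform P-property -/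

/-- Only the factor `1 + (∑ i, |ℏ| ^ 2 * pmax i) / σ²`, which is at least `1`, separates `Q` from a
row and column scaling of the comparison matrix of the cross gains; hence the positive vector
that `Q` maps to a positive one yields weighted diagonal dominance of the cross gains. -/
theorem exists_crossGain_dominant (hQ : IsPMatrix N.Q) :
    (∀ i, 0 < N.α i) ∧ ∃ v : Fin M → ℝ, (∀ i, 0 < v i) ∧
      ∀ i, ∑ l ∈ Finset.univ.erase i, N.crossGain i l * v l < N.crossGain i i * v i := by
  have hα : ∀ i, 0 < N.α i := by
    intro i
    have := hQ.det_submatrix_pos (m := 1) (f := fun _ => i) (Function.injective_of_subsingleton _)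
    have h2 : 0 < N.α i * N.W := by simpa [Q] using this
    exact pos_of_mul_pos_left h2 N.W_pos.le
  have hβ : ∀ q, 1 ≤ 1 + (∑ i, N.crossGain q i * N.pmax i) / N.noise := fun q =>
    le_add_of_nonneg_right (div_nonneg (Finset.sum_nonneg fun i _ =>
      mul_nonneg (N.crossGain_nonneg q i) (N.pmax_nonneg i)) N.noise_pos.le)
  have hQne : ∀ p q, p ≠ q → N.Q p q = -(N.α p * N.W * (N.crossGain p q / N.crossGain q q *
      (1 + (∑ i, N.crossGain q i * N.pmax i) / N.noise))) := by
    intro p q hpq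
    simp only [Q, Matrix.of_apply, if_neg hpq, abs_div, div_pow, abs_hbar_sel_sq]
    ring
  have hratio : ∀ p q, 0 ≤ N.crossGain p q / N.crossGain q q := fun p q =>
    div_nonneg (N.crossGain_nonneg p q) (N.crossGain_nonneg q q)
  have hαW : ∀ i, 0 < N.α i * N.W := fun i => mul_pos (hα i) N.W_pos
  obtain ⟨d, hd, hQd⟩ := Matrix.exists_pos_mulVec_pos_of_minors_pos N.Q
    (fun p q hpq => by
      rw [hQne p q hpq]
      exact neg_nonpos.2 (mul_nonneg (hαW p).le
        (mul_nonneg (hratio p q) (zero_le_one.trans (hβ q)))))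
    (fun m f hf => hQ.det_submatrix_pos hf)
  refine ⟨hα, fun l => d l / N.crossGain l l, fun l => div_pos (hd l) (N.crossGain_self_pos l),
    fun i => ?_⟩
  have h1 := hQd i
  rw [Matrix.mulVec, dotProduct, ← Finset.add_sum_erase _ _ (Finset.mem_univ i)] at h1
  have h2 : ∑ l ∈ Finset.univ.erase i, N.Q i l * d l ≤
      -(N.α i * N.W * ∑ l ∈ Finset.univ.erase i, N.crossGain i l * (d l / N.crossGain l l)) := by
    rw [Finset.mul_sum, ← Finset.sum_neg_distrib]
    refine Finset.sum_le_sum fun l hl => ?_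
    rw [hQne i l (Finset.ne_of_mem_erase hl).symm, neg_mul, neg_le_neg_iff, mul_assoc _ _ (d l)]
    refine mul_le_mul_of_nonneg_left ?_ (hαW i).le
    calc N.crossGain i l * (d l / N.crossGain l l)
        = N.crossGain i l / N.crossGain l l * 1 * d l := by ring
      _ ≤ _ := mul_le_mul_of_nonneg_right
          (mul_le_mul_of_nonneg_left (hβ l) (hratio i l)) (hd l).le
  have h3 : N.Q i i = N.α i * N.W := by simp [Q]
  rw [h3] at h1
  rw [mul_div_cancel₀ _ (N.crossGain_self_pos i).ne']
  have h4 : 0 < N.α i * N.W *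
      (d i - ∑ l ∈ Finset.univ.erase i, N.crossGain i l * (d l / N.crossGain l l)) := by linarith
  exact sub_pos.1 (pos_of_mul_pos_right h4 (hαW i).le)

theorem received_sub (x y : Fin M → ℝ) (i : Fin M) :
    N.received x i - N.received y i = ∑ l, N.crossGain i l * (x l - y l) := by
  simp only [received, mul_sub, Finset.sum_sub_distrib]
  ring

/-- Row `i` of the increment of `F` is a positive multiple, bounded below on the action spaces, of
row `i` of the cross gains applied to the increment of the powers. -/
theorem isUniformlyPFunctionOn_F [NeZero M] (hα : ∀ i, 0 < N.α i) {v : Fin M → ℝ}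
    (hv : ∀ i, 0 < v i)
    (hd : ∀ i, ∑ l ∈ Finset.univ.erase i, N.crossGain i l * v l < N.crossGain i i * v i) :
    IsUniformlyPFunctionOn N.profiles N.F := by
  obtain ⟨κ, hκ, hcoer⟩ := exists_coercive_of_dominant N.crossGain_nonneg hv hd
  have hτ := N.received_pos N.pmax_nonneg
  let w : Fin M → ℝ := fun i => N.α i * N.W * N.crossGain i i / N.received N.pmax i ^ 2
  have hw : ∀ i, 0 < w i := fun i =>
    div_pos (mul_pos (mul_pos (hα i) N.W_pos) (N.crossGain_self_pos i)) (pow_pos (hτ i) 2)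
  obtain ⟨i₀, -, hi₀⟩ := Finset.exists_min_image Finset.univ w Finset.univ_nonempty
  refine ⟨w i₀ * κ, mul_pos (hw i₀) hκ, fun p hp p' hp' => ?_⟩
  have hsq : ∑ i, ∑ j, (p i j - p' i j) ^ 2 =
      ∑ i, (p i (N.sel i) - p' i (N.sel i)) ^ 2 :=
    Finset.sum_congr rfl fun i _ => N.sum_eq_sel (f := fun j => (p i j - p' i j) ^ 2)
      fun j hj => by simp [(hp i).2.2 j hj, (hp' i).2.2 j hj]
  obtain ⟨i, hi⟩ := hcoer fun l => p l (N.sel l) - p' l (N.sel l)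
  refine le_trans ?_ (Finset.le_sup' _ (Finset.mem_univ i))
  rw [hsq, N.sum_eq_sel (f := fun j => (p i j - p' i j) * (N.F p i j - N.F p' i j))
    fun j hj => by simp [(hp i).2.2 j hj, (hp' i).2.2 j hj], N.F_sel hp, N.F_sel hp']
  have hT := N.received_pos (x := fun l => p l (N.sel l)) (fun l => (hp l).1 _) i
  have hT' := N.received_pos (x := fun l => p' l (N.sel l)) (fun l => (hp' l).1 _) i
  have hle := N.received_mono (x := fun l => p l (N.sel l)) (fun l => N.le_pmax (hp l)) i
  have hle' := N.received_mono (x := fun l => p' l (N.sel l)) (fun l => N.le_pmax (hp' l)) i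
  rw [← N.received_sub] at hi
  set T := N.received (fun l => p l (N.sel l)) i
  set T' := N.received (fun l => p' l (N.sel l)) i
  set S := ∑ i, (p i (N.sel i) - p' i (N.sel i)) ^ 2
  have hS : 0 ≤ S := Finset.sum_nonneg fun _ _ => sq_nonneg _
  have hTT : w i₀ ≤ N.α i * N.W * N.crossGain i i / (T * T') := by
    refine (hi₀ i (Finset.mem_univ i)).trans ?_
    refine div_le_div_of_nonneg_left
      (mul_pos (mul_pos (hα i) N.W_pos) (N.crossGain_self_pos i)).le (mul_pos hT hT') ?_
    rw [sq]
    exact mul_le_mul hle hle' hT'.le (hT.le.trans hle)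
  calc w i₀ * κ * S = w i₀ * (κ * S) := mul_assoc _ _ _
    _ ≤ N.α i * N.W * N.crossGain i i / (T * T') *
          ((p i (N.sel i) - p' i (N.sel i)) * (T - T')) :=
        mul_le_mul hTT hi (mul_nonneg hκ.le hS) ((hw i₀).le.trans hTT)
    _ = _ := by
        field_simp
        ring

/-- Two solutions of the first-order conditions make every term of the maximum nonpositive. -/
theorem IsNash.eq_of_isUniformlyPFunctionOn [NeZero M] {N : PowerNetwork M K}
    (hF : IsUniformlyPFunctionOn N.profiles N.F) {p p' : N.Profile} (hp : N.IsNash p)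
    (hp' : N.IsNash p') : p = p' := by
  obtain ⟨C, hC, h⟩ := hF
  have hsup := h p hp.1 p' hp'.1
  have hle : (Finset.univ.sup' Finset.univ_nonempty
      fun i => ∑ j, (p i j - p' i j) * (N.F p i j - N.F p' i j)) ≤ 0 := by
    refine Finset.sup'_le _ _ fun i _ => ?_
    rw [N.sum_eq_sel (f := fun j => (p i j - p' i j) * (N.F p i j - N.F p' i j))
      fun j hj => by simp [(hp.1 i).2.2 j hj, (hp'.1 i).2.2 j hj]]
    have h1 := hp.variational i ((hp'.1 i).1 (N.sel i)) (N.le_pmax (hp'.1 i))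
    have h2 := hp'.variational i ((hp.1 i).1 (N.sel i)) (N.le_pmax (hp.1 i))
    linarith
  have hterm : ∀ i, 0 ≤ ∑ j, (p i j - p' i j) ^ 2 := fun i =>
    Finset.sum_nonneg fun _ _ => sq_nonneg _
  have hzero : ∑ i, ∑ j, (p i j - p' i j) ^ 2 = 0 :=
    le_antisymm (nonpos_of_mul_nonpos_right (hsup.trans hle) hC)
      (Finset.sum_nonneg fun i _ => hterm i)
  funext i j
  have h1 := (Finset.sum_eq_zero_iff_of_nonneg fun i _ => hterm i).1 hzero i (Finset.mem_univ i)
  have h2 := (Finset.sum_eq_zero_iff_of_nonneg fun j _ => sq_nonneg (p i j - p' i j)).1 h1 j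
    (Finset.mem_univ j)
  exact sub_eq_zero.1 (pow_eq_zero_iff two_ne_zero |>.1 h2)

/-! ### Best responses -/

/-- The water-filling best response of BS `i` to the powers `x` of the other BSs: the projection to
`[0, pmax i]` of the power at which the marginal payoff vanishes. Without a price on power the
payoff is increasing in the own power, and the response is full power. -/
noncomputable def bestResponse (x : Fin M → ℝ) (i : Fin M) : ℝ :=
  if N.lam i = 0 then N.pmax i
  else max 0 (min (N.pmax i) (N.α i * N.W / N.lam i -
    (∑ l ∈ Finset.univ.erase i, N.crossGain i l * x l + N.noise) / N.crossGain i i))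

theorem abs_bestResponse_sub_le (x y : Fin M → ℝ) (i : Fin M) :
    |N.bestResponse x i - N.bestResponse y i| ≤
      (∑ l ∈ Finset.univ.erase i, N.crossGain i l * |x l - y l|) / N.crossGain i i := by
  have hc := N.crossGain_self_pos i
  unfold bestResponse
  split_ifs
  · rw [sub_self, abs_zero]
    exact div_nonneg (Finset.sum_nonneg fun l _ =>
      mul_nonneg (N.crossGain_nonneg i l) (abs_nonneg _)) hc.le
  · have hclip : ∀ P a b : ℝ, |max 0 (min P a) - max 0 (min P b)| ≤ |a - b| := fun P a b => by
      have h1 := abs_max_sub_max_le_max 0 (min P a) 0 (min P b)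
      have h2 := abs_min_sub_min_le_max P a P b
      rw [sub_self, abs_zero] at h1 h2
      rw [max_eq_right (abs_nonneg (min P a - min P b))] at h1
      rw [max_eq_right (abs_nonneg (a - b))] at h2
      exact h1.trans h2
    refine (hclip _ _ _).trans ?_
    rw [sub_sub_sub_cancel_left, ← sub_div, add_sub_add_right_eq_sub, ← Finset.sum_sub_distrib,
      abs_div, abs_of_pos hc]
    refine div_le_div_of_nonneg_right ((Finset.abs_sum_le_sum_abs _ _).trans
      (Finset.sum_le_sum fun l _ => ?_)) hc.le
    rw [← mul_sub, abs_mul, abs_of_nonneg (N.crossGain_nonneg i l), abs_sub_comm]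

theorem isNash_of_bestResponse_eq {x : Fin M → ℝ} (hx : N.bestResponse x = x) :
    N.IsNash fun i => Pi.single (N.sel i) (x i) := by
  have h0 : ∀ i, 0 ≤ x i := fun i => by
    rw [← hx, bestResponse]
    split_ifs
    exacts [N.pmax_nonneg i, le_max_left _ _]
  have h1 : ∀ i, x i ≤ N.pmax i := fun i => by
    rw [← hx, bestResponse]
    split_ifs
    exacts [le_rfl, max_le (N.pmax_nonneg i) (min_le_left _ _)]
  have hp : (fun i => Pi.single (N.sel i) (x i) : N.Profile) ∈ N.profiles :=
    fun i => N.single_mem_actions (h0 i) (h1 i)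
  refine N.isNash_of_variational hp fun i t ht0 ht1 => ?_
  rw [N.F_sel hp]
  simp only [Pi.single_eq_same]
  have hc := N.crossGain_self_pos i
  have hT := N.received_pos h0 i
  have hαW := mul_nonneg (N.α_nonneg i) N.W_pos.le
  have hxi := congrFun hx i
  rw [bestResponse] at hxi
  split_ifs at hxi with hlam
  · rw [hlam, zero_sub, ← hxi]
    exact mul_nonneg_of_nonpos_of_nonpos (sub_nonpos.2 ht1)
      (neg_nonpos.2 (mul_nonneg hαW (div_pos hc hT).le))
  · have hl : 0 < N.lam i := lt_of_le_of_ne (N.lam_nonneg i) (Ne.symm hlam)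
    set D := ∑ l ∈ Finset.univ.erase i, N.crossGain i l * x l + N.noise with hD
    set s := N.α i * N.W / N.lam i - D / N.crossGain i i with hs
    have hTD : N.received x i = N.crossGain i i * x i + D := N.received_eq x i
    -- The marginal payoff vanishes at `s`, and `x i` is the point of `[0, pmax i]` nearest to `s`.
    have hkey : N.lam i - N.α i * N.W * (N.crossGain i i / N.received x i) =
        N.lam i * N.crossGain i i * (x i - s) / N.received x i := by
      have : N.lam i * N.crossGain i i * (x i - s) =
          N.lam i * N.received x i - N.α i * N.W * N.crossGain i i := by
        rw [hTD, hs]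
        field_simp
        ring
      rw [this]
      field_simp
    have hproj : 0 ≤ (t - x i) * (x i - s) := by
      rcases le_total s 0 with h | h
      · have hx0 : x i = 0 := by rw [← hxi]; exact max_eq_left ((min_le_right _ _).trans h)
        rw [hx0]
        exact mul_nonneg (by linarith) (by linarith)
      · rcases le_total s (N.pmax i) with h' | h'
        · rw [min_eq_right h', max_eq_right h] at hxi
          simp [← hxi]
        · rw [min_eq_left h', max_eq_right (N.pmax_nonneg i)] at hxi
          rw [← hxi]
          exact mul_nonneg_of_nonpos_of_nonpos (by linarith) (by linarith)
    rw [hkey]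
    calc (0 : ℝ) ≤ N.lam i * N.crossGain i i / N.received x i * ((t - x i) * (x i - s)) :=
          mul_nonneg (div_pos (mul_pos hl hc) hT).le hproj
      _ = _ := by ring

end PowerNetwork

theorem theorem1 {M K : ℕ} [NeZero M] (N : PowerNetwork M K) (hQ : IsPMatrix N.Q) :
    IsUniformlyPFunctionOn N.profiles N.F ∧ ∃! p : N.Profile, N.IsNash p := by
  obtain ⟨hα, v, hv, hd⟩ := N.exists_crossGain_dominant hQ
  have hF := N.isUniformlyPFunctionOn_F hα hv hd
  obtain ⟨x, hx⟩ := exists_fixedPoint_of_dominant N.crossGain_nonneg N.crossGain_self_pos hv hd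
    N.abs_bestResponse_sub_le
  have hN := N.isNash_of_bestResponse_eq hx
  exact ⟨hF, _, hN, fun p hp => hp.eq_of_isUniformlyPFunctionOn hF hN⟩
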